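/- Let $d\ge 1$. On the tropical projective torus $\mathbb{R}^d/\mathbb{R}\mathbf{1}$, $\mathbf 1=(1,\dots,1)$, a set is called min-convex (max-convex) if it is closed under linear combinations in the min-plus (max-plus) algebra; the min-plus (max-plus) hull of a set is the smallest min-convex (max-convex) set containing it. A min-plus (max-plus) vertex of a set $S$ is a point of $S$ that is not in the min-plus (max-plus) hull of the other points of $S$. A set is a min-plus (max-plus) simplex if it has nonempty interior, has exactly $d$ min-plus (max-plus) vertices, and is their min-plus (max-plus) hull. The polytrope region $\mathcal{P}_d$ is the set of real $d\times d$ matrices $M=(m_{ij})$ with zero diagonal that are idempotent for the min-plus matrix product, i.e. $m_{ik}=\min_j(m_{ij}+m_{jk})$ for all $i,k$. The matrix $M$ is in standard form if $m_{ij}\ge 0$ for all $i,j$ and $m_{ij}+m_{ji}>0$ for all $i\ne j$. Put $Q_M=\{u\in\mathbb{R}^d/\mathbb{R}\mathbf{1} : u_i-u_j\le m_{ij}\text{ for all } i,j\}$. Let $K$ be a field with a surjective discrete valuation $\mathrm{val}:K\to\mathbb{Z}\cup\{\infty\}$ and valuation ring $\mathcal{O}_K$. A lattice in $K^d$ is a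 free $\mathcal{O}_K$-submodule of rank $d$. For an integer matrix $M\in\mathcal{P}_d$ let $\Lambda_M=\{X\in K^{d\times d} : \mathrm{val}(x_{ij})\ge m_{ij}\text{ for all } i,j\}$, which is a ring, and for $u\in\mathbb{Z}^d$ let $L_u=\{x\in K^d : \mathrm{val}(x_i)\ge u_i\text{ for all } i\}$. If $[u]\in Q_M$, then $L_u$ is stable under $\Lambda_M$, hence a $\Lambda_M$-module. A $\Lambda_M$-module that is finitely generated and free over $\mathcal{O}_K$ is called injective as a lattice if homomorphisms into it extend along every embedding $X\hookrightarrow Y$ of such modules whose cokernel is again free over $\mathcal{O}_K$. **Theorem.** (1) Let $M\in\mathcal{P}_d$ be in standard form. Then the polytrope $Q_M$ is $(d-1)$-dimensional and is both a min-plus simplex and a max-plus simplex. Its min-plus vertices are the classes of the columns of $M$, and its max-plus vertices are the classes of the columns of $-M^t$. (2) Suppose moreover that $M$ has integer entries. For $u\in\mathbb{Z}^d$ with $[u]\in Q_M$, the class $[u]$ is a min-plus vertex of $Q_M$ if and only if $L_u$ is a projective $\Lambda_M$-module, and $[u]$ is a max-plus vertex of $Q_M$ if and only if $L_u$ is injective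 as a $\Lambda_M$-lattice. More precisely, a $\Lambda_M$-stable lattice $L$ in $K^d$ is projective as a $\Lambda_M$-module (respectively, injective as a $\Lambda_M$-lattice) if and only if $L=L_u$ for some $u\in\mathbb{Z}^d$ whose class is a min-plus (respectively, max-plus) vertex of $Q_M$. -/

import Mathlib

open scoped Matrix

universe u

/-! ### The tropical projective torus and tropical convexity -/

/-- The tropical projective torus `ℝ^d / ℝ𝟏`. -/
abbrev TropTorus (d : ℕ) : Type :=
  (Fin d → ℝ) ⧸ (Submodule.span ℝ {(1 : Fin d → ℝ)})

/-- The class of a vector in `ℝ^d / ℝ𝟏`. -/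
def tropClass {d : ℕ} (u : Fin d → ℝ) : TropTorus d := Submodule.Quotient.mk u

/-- The class in `ℝ^d / ℝ𝟏` of an integer vector. -/
def intClass {d : ℕ} (u : Fin d → ℤ) : TropTorus d := tropClass fun i => (u i : ℝ)

/-- A subset of `ℝ^d / ℝ𝟏` is min-convex if it is closed under min-plus linear combinations
`(a ⊙ u) ⊕ (b ⊙ w)` (computed on representatives). -/
def IsMinConvex {d : ℕ} (S : Set (TropTorus d)) : Prop :=
  ∀ (u w : Fin d → ℝ) (a b : ℝ), tropClass u ∈ S → tropClass w ∈ S →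
    tropClass (fun i => min (a + u i) (b + w i)) ∈ S

/-- A subset of `ℝ^d / ℝ𝟏` is max-convex if it is closed under max-plus linear combinations. -/
def IsMaxConvex {d : ℕ} (S : Set (TropTorus d)) : Prop :=
  ∀ (u w : Fin d → ℝ) (a b : ℝ), tropClass u ∈ S → tropClass w ∈ S →
    tropClass (fun i => max (a + u i) (b + w i)) ∈ S

/-- The min-plus convex hull: the smallest min-convex set containing `S`. -/
def minHull {d : ℕ} (S : Set (TropTorus d)) : Set (TropTorus d) :=
  ⋂₀ {T | IsMinConvex T ∧ S ⊆ T}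

/-- The max-plus convex hull: the smallest max-convex set containing `S`. -/
def maxHull {d : ℕ} (S : Set (TropTorus d)) : Set (TropTorus d) :=
  ⋂₀ {T | IsMaxConvex T ∧ S ⊆ T}

/-- The min-plus vertices of `S`: the points of `S` that are not in the min-plus convex hull of
the other points of `S`. -/
def minVertices {d : ℕ} (S : Set (TropTorus d)) : Set (TropTorus d) :=
  {x | x ∈ S ∧ x ∉ minHull (S \ {x})}

/-- The max-plus vertices of `S`: the points of `S` that are not in the max-plus convex hull of
the other points of `S`. -/
def maxVertices {d : ℕ} (S : Set (TropTorus d)) : Set (TropTorus d) :=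
  {x | x ∈ S ∧ x ∉ maxHull (S \ {x})}

/-- A (full-dimensional) min-plus simplex in the `(d-1)`-dimensional space `ℝ^d / ℝ𝟏`: a set with
nonempty interior that has exactly `d` min-plus vertices and is their min-plus convex hull. -/
def IsMinPlusSimplex {d : ℕ} (S : Set (TropTorus d)) : Prop :=
  (interior S).Nonempty ∧ (minVertices S).encard = d ∧ minHull (minVertices S) = S

/-- A (full-dimensional) max-plus simplex in the `(d-1)`-dimensional space `ℝ^d / ℝ𝟏`: a set with
nonempty interior that has exactly `d` max-plus vertices and is their max-plus convex hull. -/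
def IsMaxPlusSimplex {d : ℕ} (S : Set (TropTorus d)) : Prop :=
  (interior S).Nonempty ∧ (maxVertices S).encard = d ∧ maxHull (maxVertices S) = S

/-! ### The polytrope region and polytropes -/

/-- The matrix product in the min-plus algebra (the infimum is over a finite set). -/
noncomputable def minPlusMul {d : ℕ} (M N : Matrix (Fin d) (Fin d) ℝ) :
    Matrix (Fin d) (Fin d) ℝ :=
  Matrix.of fun i k => ⨅ j, (M i j + N j k)

/-- The polytrope region: min-plus idempotent real matrices with zero diagonal. -/
def polytropeRegion (d : ℕ) : Set (Matrix (Fin d) (Fin d) ℝ) :=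
  {M | (∀ i, M i i = 0) ∧ minPlusMul M M = M}

/-- Standard form: `M ≥ 0` entrywise and `m_ij + m_ji > 0` for `i ≠ j`. -/
def IsStandardForm {d : ℕ} (M : Matrix (Fin d) (Fin d) ℝ) : Prop :=
  (∀ i j, 0 ≤ M i j) ∧ ∀ i j, i ≠ j → 0 < M i j + M j i

/-- The polytrope `Q_M = {u ∈ ℝ^d / ℝ𝟏 : u_i - u_j ≤ m_ij}`. -/
def polytrope {d : ℕ} (M : Matrix (Fin d) (Fin d) ℝ) : Set (TropTorus d) :=
  tropClass '' {u | ∀ i j, u i - u j ≤ M i j}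

/-- An integer matrix regarded as a real matrix. -/
def realMatrix {d : ℕ} (M : Matrix (Fin d) (Fin d) ℤ) : Matrix (Fin d) (Fin d) ℝ :=
  M.map fun m => (m : ℝ)

theorem polytropeRegion_triangle {d : ℕ} {M : Matrix (Fin d) (Fin d) ℝ}
    (hM : M ∈ polytropeRegion d) (i j k : Fin d) : M i k ≤ M i j + M j k := by
  have h : M i k = ⨅ j, (M i j + M j k) := by
    conv_lhs => rw [← hM.2]
    rfl
  rw [h]
  exact ciInf_le (Set.finite_range _).bddBelow j

theorem tropClass_mem_polytrope {d : ℕ} {M : Matrix (Fin d) (Fin d) ℝ} {u : Fin d → ℝ} :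
    tropClass u ∈ polytrope M ↔ ∀ i j, u i - u j ≤ M i j := by
  constructor
  · rintro ⟨w, hw, h⟩ i j
    have h' := (Submodule.Quotient.eq _).1 h
    obtain ⟨c, hc⟩ := Submodule.mem_span_singleton.1 h'
    have hi := congrFun hc i
    have hj := congrFun hc j
    simp at hi hj
    have := hw i j
    linarith
  · exact fun h => ⟨u, h, rfl⟩

/-! ### Graduated orders and their lattices -/

section Valued

variable {K : Type u} [Field K] (v : AddValuation K (WithTop ℤ))

/-- The valuation ring `𝒪_K = {x : val x ≥ 0}`. -/
def valRing : ValuationSubring K where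
  carrier := {x | 0 ≤ v x}
  zero_mem' := by simp
  one_mem' := by simp
  mul_mem' {x y} hx hy := by
    simp only [Set.mem_ofPred_eq, AddValuation.map_mul] at *
    exact add_nonneg hx hy
  add_mem' {x y} hx hy := le_trans (le_min hx hy) (v.map_add x y)
  neg_mem' {x} hx := by simpa using hx
  mem_or_inv_mem' x := by
    by_cases h : 0 ≤ v x
    · exact Or.inl h
    · right
      have hx : x ≠ 0 := by rintro rfl; simp at h
      have h1 : v x + v x⁻¹ = 0 := by rw [← v.map_mul, mul_inv_cancel₀ hx, v.map_one]
      by_contra h2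
      have h2' : v x⁻¹ < 0 := not_le.1 h2
      have h' : v x < 0 := not_le.1 h
      obtain ⟨a, ha⟩ := WithTop.ne_top_iff_exists.1 h'.ne_top
      obtain ⟨b, hb⟩ := WithTop.ne_top_iff_exists.1 h2'.ne_top
      rw [← ha] at h1 h'
      rw [← hb] at h1 h2'
      norm_cast at h1 h' h2'
      omega

variable {d : ℕ}

/-- The graduated order `Λ_M = {X ∈ K^{d×d} : val X ≥ M}` of an integer matrix `M` in the
polytrope region, as an `𝒪_K`-subalgebra of `K^{d×d}`. -/
def gradOrder (M : Matrix (Fin d) (Fin d) ℤ) (hM : realMatrix M ∈ polytropeRegion d) :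
    Subalgebra (valRing v) (Matrix (Fin d) (Fin d) K) where
  carrier := {X | ∀ i j, ((M i j : ℤ) : WithTop ℤ) ≤ v (X i j)}
  mul_mem' {X Y} hX hY i k := by
    rw [Matrix.mul_apply]
    refine v.map_le_sum fun j _ => ?_
    rw [v.map_mul]
    refine le_trans ?_ (add_le_add (hX i j) (hY j k))
    have h : M i k ≤ M i j + M j k := by
      have := polytropeRegion_triangle hM i j k
      simp only [realMatrix, Matrix.map_apply] at this
      exact_mod_cast this
    exact_mod_cast h
  add_mem' {X Y} hX hY i j := le_trans (le_min (hX i j) (hY i j)) (v.map_add _ _)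
  algebraMap_mem' r i j := by
    have h0 : M i i = 0 := by
      have := hM.1 i
      simp only [realMatrix, Matrix.map_apply] at this
      exact_mod_cast this
    rw [Matrix.algebraMap_matrix_apply]
    split_ifs with h
    · subst h
      rw [h0]
      exact r.2
    · simp

/-- The diagonal lattice `L_u = diag(p^{u_1}, …, p^{u_d}) 𝒪_K^d = {x ∈ K^d : val x_i ≥ u_i}`. -/
def diagLattice (u : Fin d → ℤ) : Submodule (valRing v) (Fin d → K) where
  carrier := {x | ∀ i, ((u i : ℤ) : WithTop ℤ) ≤ v (x i)}
  zero_mem' i := by simp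
  add_mem' {x y} hx hy i := le_trans (le_min (hx i) (hy i)) (v.map_add _ _)
  smul_mem' c x hx i := by
    change _ ≤ v ((c : K) * x i)
    rw [v.map_mul]
    exact le_trans (hx i) (le_add_of_nonneg_left c.2)

/-- The two descriptions of `L_u` agree. -/
theorem mem_diagLattice_iff {p : K} (hp : v p = 1) (u : Fin d → ℤ) (x : Fin d → K) :
    x ∈ diagLattice v u ↔
      ∃ y : Fin d → K, (∀ i, y i ∈ valRing v) ∧ x = Matrix.diagonal (fun i => p ^ u i) *ᵥ y := by
  have hp0 : p ≠ 0 := by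
    rintro rfl
    rw [v.map_zero] at hp
    exact absurd hp (by decide)
  have hpow : ∀ n : ℤ, v (p ^ n) = ((n : ℤ) : WithTop ℤ) := by
    have hnat : ∀ n : ℕ, v (p ^ n) = ((n : ℤ) : WithTop ℤ) := fun n => by
      rw [v.map_pow, hp, nsmul_one]; rfl
    intro n
    obtain ⟨n, rfl | rfl⟩ := n.eq_nat_or_neg
    · rw [zpow_natCast, hnat]
    · have h1 : v (p ^ n) + v (p ^ (-(n : ℤ))) = 0 := by
        rw [← v.map_mul, zpow_neg, zpow_natCast, mul_inv_cancel₀ (pow_ne_zero n hp0), v.map_one]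
      rw [hnat] at h1
      have h2 : v (p ^ (-(n : ℤ))) ≠ ⊤ := fun h => by rw [h] at h1; simp at h1
      obtain ⟨b, hb⟩ := WithTop.ne_top_iff_exists.1 h2
      rw [← hb] at h1 ⊢
      norm_cast at h1 ⊢
      omega
  constructor
  · intro hx
    refine ⟨fun i => p ^ (-u i) * x i, fun i => ?_, ?_⟩
    · change 0 ≤ v (p ^ (-u i) * x i)
      rw [v.map_mul, hpow]
      refine le_trans (le_of_eq ?_) (add_le_add_right (hx i) _)
      norm_cast
      omega
    · ext i
      rw [Matrix.mulVec_diagonal, ← mul_assoc, ← zpow_add₀ hp0]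
      simp
  · rintro ⟨y, hy, rfl⟩ i
    rw [Matrix.mulVec_diagonal, v.map_mul, hpow]
    exact le_add_of_nonneg_right (hy i)

/-- For `[u] ∈ Q_M` the lattice `L_u` is stable under `Λ_M`; this is `L_u` as a `Λ_M`-module. -/
def gradLattice (M : Matrix (Fin d) (Fin d) ℤ) (hM : realMatrix M ∈ polytropeRegion d)
    (u : Fin d → ℤ) (hu : intClass u ∈ polytrope (realMatrix M)) :
    Submodule (gradOrder v M hM) (Fin d → K) where
  carrier := diagLattice v u
  zero_mem' := (diagLattice v u).zero_mem
  add_mem' := (diagLattice v u).add_mem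
  smul_mem' X x hx i := by
    change _ ≤ v (∑ j, (X : Matrix (Fin d) (Fin d) K) i j * x j)
    refine v.map_le_sum fun j _ => ?_
    rw [v.map_mul]
    refine le_trans ?_ (add_le_add (X.2 i j) (hx j))
    have h : u i ≤ M i j + u j := by
      have := tropClass_mem_polytrope.1 hu i j
      simp only [realMatrix, Matrix.map_apply] at this
      have : (u i : ℝ) ≤ M i j + u j := by linarith
      exact_mod_cast this
    exact_mod_cast h

end Valued

/-- Let `Λ` be an algebra over a (local principal ideal) domain `R`. A `Λ`-lattice is a `Λ`-module
that is finitely generated and free over `R`. A `Λ`-lattice `L` is injective (as a lattice) if every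
homomorphism `X → L` extends along every embedding `X ↪ Y` of `Λ`-lattices whose cokernel is again
a `Λ`-lattice. -/
def IsInjectiveLattice (R Λ : Type u) [CommRing R] [Ring Λ] [Algebra R Λ]
    (L : Type u) [AddCommGroup L] [Module R L] [Module Λ L] [IsScalarTower R Λ L] : Prop :=
  Module.Finite R L ∧ Module.Free R L ∧
  ∀ (X Y : Type u) [AddCommGroup X] [AddCommGroup Y] [Module R X] [Module R Y]
    [Module Λ X] [Module Λ Y] [IsScalarTower R Λ X] [IsScalarTower R Λ Y]
    [Module.Finite R X] [Module.Free R X] [Module.Finite R Y] [Module.Free R Y]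
    (f : X →ₗ[Λ] Y), Function.Injective f → Module.Free R (Y ⧸ LinearMap.range f) →
    ∀ g : X →ₗ[Λ] L, ∃ h : Y →ₗ[Λ] L, h ∘ₗ f = g

/-!
The polytrope `Q_M` is closed under both kinds of tropical combinations. Every `u ∈ Q_M` satisfies
`u_i = min_j (u_j + m_ij)`, so the columns of `M` generate `Q_M`
(`mem_of_isMinConvex_of_col_mem`). They are needed: if a combination of two points of `Q_M` is the
`j`-th column, the point attaining the minimum in the coordinate `j` is already that column, so
that `Q_M` without the column is still min-convex (`isMinConvex_polytrope_diff_col`). The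
inequalities `m_ij + m_ji > 0` make the columns distinct and put their average into the interior.
The max-plus statements follow by the symmetry `u ↦ -u`, which exchanges `Q_M` and the polytrope
of the transpose.

For the lattices, the matrix units in `Λ_M` have two consequences. Every stable lattice is some
`L_u` (`exists_eq_gradLattice`), and every homomorphism `L_u → L_w` is multiplication by a scalar
(`exists_scalar_of_hom`). If `u` is a translate of the `j`-th column of `M`, then `L_u ≅ Λ_M e_jj`
is a direct summand of `Λ_M`. Conversely, `L_u` is the sum of the sublattices belonging to the
translated columns `u_j + m_ij`; if `L_u` is projective, this presentation splits by scalars that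
add up to `1`, and a scalar of valuation at most `0` among them shows that one of the sublattices
is all of `L_u` (`exists_col_of_projective`).

Dually, if `-u` is a translate of the `j`-th row of `M`, homomorphisms from a `Λ_M`-lattice into
`L_u` correspond to `𝒪_K`-linear forms, which extend along embeddings with free cokernel
(`exists_hom_of_linearForm`). Conversely, `L_u` is the intersection of the lattices belonging to
`u_j - m_ji` and is pure in their product, so if `L_u` is injective, a retraction again yields
scalars with sum `1` (`exists_row_of_isInjectiveLattice`).
-/

/-! ### Tropical convexity in the torus -/

theorem tropClass_eq_iff {d : ℕ} {u w : Fin d → ℝ} :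
    tropClass u = tropClass w ↔ ∃ c : ℝ, ∀ i, u i = c + w i := by
  unfold tropClass
  rw [Submodule.Quotient.eq, Submodule.mem_span_singleton]
  refine exists_congr fun c => ?_
  rw [funext_iff]
  refine forall_congr' fun i => ?_
  simp only [Pi.smul_apply, Pi.one_apply, smul_eq_mul, mul_one, Pi.sub_apply]
  constructor <;> intro h <;> linarith

theorem tropClass_surjective {d : ℕ} : Function.Surjective (tropClass (d := d)) :=
  Submodule.Quotient.mk_surjective _

theorem subset_minHull {d : ℕ} (S : Set (TropTorus d)) : S ⊆ minHull S :=
  fun _ hx _ hT => hT.2 hx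

theorem isMinConvex_minHull {d : ℕ} (S : Set (TropTorus d)) : IsMinConvex (minHull S) :=
  fun u w a b hu hw T hT => hT.1 u w a b (hu T hT) (hw T hT)

theorem minHull_subset {d : ℕ} {S T : Set (TropTorus d)} (hT : IsMinConvex T) (h : S ⊆ T) :
    minHull S ⊆ T :=
  fun _ hx => hx T ⟨hT, h⟩

theorem IsMinConvex.inf'_mem {d : ℕ} {T : Set (TropTorus d)} (hT : IsMinConvex T)
    {ι : Type*} (f : ι → Fin d → ℝ) (a : ι → ℝ) {s : Finset ι} (hs : s.Nonempty)
    (hf : ∀ j ∈ s, tropClass (f j) ∈ T) :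
    tropClass (fun i => s.inf' hs fun j => a j + f j i) ∈ T := by
  induction hs using Finset.Nonempty.cons_induction with
  | singleton j =>
    have h := hT (f j) (f j) (a j) (a j) (hf j (by simp)) (hf j (by simp))
    simpa using h
  | cons j s hj hs ih =>
    have h := hT (f j) _ (a j) 0 (hf j (by simp))
      (ih fun k hk => hf k (Finset.mem_cons_of_mem hk))
    simpa [Finset.inf'_cons hs] using h

theorem isMinConvex_polytrope {d : ℕ} (M : Matrix (Fin d) (Fin d) ℝ) :
    IsMinConvex (polytrope M) := by
  intro u w a b hu hw
  rw [tropClass_mem_polytrope] at *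
  intro i j
  have h1 := hu i j
  have h2 := hw i j
  have h3 := min_le_left (a + u i) (b + w i)
  have h4 := min_le_right (a + u i) (b + w i)
  rcases min_choice (a + u j) (b + w j) with h | h <;> rw [h] <;> linarith

section Vertices

variable {d : ℕ} {M : Matrix (Fin d) (Fin d) ℝ}

theorem col_mem_polytrope (htri : ∀ i j k, M i k ≤ M i j + M j k) (j : Fin d) :
    tropClass (M.col j) ∈ polytrope M := by
  rw [tropClass_mem_polytrope]
  intro i k
  have := htri i k j
  simp only [Matrix.col_apply]
  linarith

/-- A point `u` of `Q_M` is the tropical combination of the columns of `M` with coefficients `u`,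
because `u i = min_j (u j + m_ij)`. -/
theorem mem_of_isMinConvex_of_col_mem (h0 : ∀ i, M i i = 0) {T : Set (TropTorus d)}
    (hT : IsMinConvex T) (hcol : ∀ j, tropClass (M.col j) ∈ T) (hd : 0 < d)
    {x : TropTorus d} (hx : x ∈ polytrope M) : x ∈ T := by
  obtain ⟨u, rfl⟩ := tropClass_surjective x
  rw [tropClass_mem_polytrope] at hx
  have hne : (Finset.univ : Finset (Fin d)).Nonempty := ⟨⟨0, hd⟩, Finset.mem_univ _⟩
  convert hT.inf'_mem (fun j => M.col j) u hne fun j _ => hcol j using 2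
  ext i
  apply le_antisymm
  · refine Finset.le_inf' _ _ fun j _ => ?_
    have := hx i j
    simp only [Matrix.col_apply]
    linarith
  · refine (Finset.inf'_le _ (Finset.mem_univ i)).trans ?_
    simp [Matrix.col_apply, h0]

/-- If a tropical combination of two points of `Q_M` is the `j`-th column of `M`, then the point
that attains the minimum in the coordinate `j` is already this column. -/
theorem isMinConvex_polytrope_diff_col (h0 : ∀ i, M i i = 0) (j : Fin d) :
    IsMinConvex (polytrope M \ {tropClass (M.col j)}) := by
  intro u w a b hu hw
  refine ⟨isMinConvex_polytrope M u w a b hu.1 hw.1, fun h => ?_⟩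
  obtain ⟨c, hc⟩ := tropClass_eq_iff.1 h
  simp only [Matrix.col_apply] at hc
  have hj := hc j
  rw [h0] at hj
  have hu1 := tropClass_mem_polytrope.1 hu.1
  have hw1 := tropClass_mem_polytrope.1 hw.1
  rcases min_choice (a + u j) (b + w j) with h | h <;> rw [h] at hj
  · refine hu.2 (tropClass_eq_iff.2 ⟨c - a, fun i => ?_⟩)
    have h1 := hu1 i j
    have h2 := hc i
    have h3 := min_le_left (a + u i) (b + w i)
    simp only [Matrix.col_apply]
    linarith
  · refine hw.2 (tropClass_eq_iff.2 ⟨c - b, fun i => ?_⟩)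
    have h1 := hw1 i j
    have h2 := hc i
    have h3 := min_le_right (a + u i) (b + w i)
    simp only [Matrix.col_apply]
    linarith

theorem minVertices_polytrope (hd : 0 < d) (h0 : ∀ i, M i i = 0)
    (htri : ∀ i j k, M i k ≤ M i j + M j k) :
    minVertices (polytrope M) = Set.range fun j => tropClass (M.col j) := by
  ext x
  constructor
  · rintro ⟨hx, hx'⟩
    by_contra hne
    exact hx' (mem_of_isMinConvex_of_col_mem h0 (isMinConvex_minHull _)
      (fun j => subset_minHull (polytrope M \ {x})
        ⟨col_mem_polytrope htri j, fun h => hne ⟨j, h⟩⟩) hd hx)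
  · rintro ⟨j, rfl⟩
    exact ⟨col_mem_polytrope htri j, fun h =>
      (minHull_subset (isMinConvex_polytrope_diff_col h0 j) subset_rfl h).2 rfl⟩

theorem tropClass_col_injective (h0 : ∀ i, M i i = 0)
    (hpos : ∀ i j, i ≠ j → 0 < M i j + M j i) :
    Function.Injective fun j => tropClass (M.col j) := by
  intro j k h
  by_contra hjk
  obtain ⟨c, hc⟩ := tropClass_eq_iff.1 h
  have h1 := hc j
  have h2 := hc k
  simp only [Matrix.col_apply, h0] at h1 h2
  have := hpos j k hjk
  linarith

/-- The average of the columns of `M` satisfies all inequalities `u i - u j ≤ m_ij`, `i ≠ j`,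
strictly: the `i`-th column does. -/
theorem interior_polytrope_nonempty (hd : 0 < d) (h0 : ∀ i, M i i = 0)
    (htri : ∀ i j k, M i k ≤ M i j + M j k) (hpos : ∀ i j, i ≠ j → 0 < M i j + M j i) :
    (interior (polytrope M)).Nonempty := by
  have hopen : IsOpen {u : Fin d → ℝ | ∀ i j, i ≠ j → u i - u j < M i j} := by
    simp only [Set.ofPred_forall]
    refine isOpen_iInter_of_finite fun i => isOpen_iInter_of_finite fun j =>
      isOpen_iInter_of_finite fun _ => isOpen_lt (by fun_prop) continuous_const
  have himg := QuotientAddGroup.isOpenMap_coe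
    (N := (Submodule.span ℝ {(1 : Fin d → ℝ)}).toAddSubgroup) _ hopen
  have hd' : (0 : ℝ) < d := by exact_mod_cast hd
  refine ⟨tropClass fun i => (∑ k, M i k) / d, mem_interior.2 ⟨_, ?_, himg, ⟨_, ?_, rfl⟩⟩⟩
  · rintro _ ⟨u, hu, rfl⟩
    refine ⟨u, fun i j => ?_, rfl⟩
    rcases eq_or_ne i j with rfl | hij
    · simp [h0]
    · exact (hu i j hij).le
  · intro i j hij
    rw [← sub_div, div_lt_iff₀ hd', ← Finset.sum_sub_distrib]
    calc ∑ k, (M i k - M j k) < ∑ _k : Fin d, M i j := by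
          refine Finset.sum_lt_sum (fun k _ => ?_) ⟨i, Finset.mem_univ i, ?_⟩
          · linarith [htri i j k]
          · rw [h0]; linarith [hpos i j hij]
      _ = M i j * d := by simp [mul_comm]

theorem isMinPlusSimplex_polytrope (hd : 0 < d) (h0 : ∀ i, M i i = 0)
    (htri : ∀ i j k, M i k ≤ M i j + M j k) (hpos : ∀ i j, i ≠ j → 0 < M i j + M j i) :
    IsMinPlusSimplex (polytrope M) := by
  refine ⟨interior_polytrope_nonempty hd h0 htri hpos, ?_, ?_⟩
  · rw [minVertices_polytrope hd h0 htri, ← Set.image_univ,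
      (tropClass_col_injective h0 hpos).encard_image, Set.encard_univ]
    simp
  · rw [minVertices_polytrope hd h0 htri]
    refine (minHull_subset (isMinConvex_polytrope M) ?_).antisymm fun x hx => ?_
    · rintro _ ⟨j, rfl⟩
      exact col_mem_polytrope htri j
    · exact mem_of_isMinConvex_of_col_mem h0 (isMinConvex_minHull _)
        (fun j => subset_minHull (Set.range _) ⟨j, rfl⟩) hd hx

end Vertices

/-- A subset of the torus with nonempty interior spans all directions. -/
theorem finrank_vectorSpan_of_interior_nonempty {d : ℕ} (hd : 0 < d) {S : Set (TropTorus d)}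
    (hS : (interior S).Nonempty) : Module.finrank ℝ (vectorSpan ℝ S) = d - 1 := by
  obtain ⟨p, hp⟩ := hS
  have htop : vectorSpan ℝ S = ⊤ := by
    refine Submodule.eq_top_of_nonempty_interior' _ ⟨0, mem_interior.2
      ⟨(fun x => x + p) ⁻¹' interior S, fun x hx => ?_,
        isOpen_interior.preimage (by fun_prop), by simpa using hp⟩⟩
    have := vsub_mem_vectorSpan ℝ (interior_subset hx) (interior_subset hp)
    simpa using this
  have : Nonempty (Fin d) := ⟨⟨0, hd⟩⟩
  have h := Submodule.finrank_quotient_add_finrank (Submodule.span ℝ {(1 : Fin d → ℝ)})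
  rw [finrank_span_singleton one_ne_zero, Module.finrank_fin_fun] at h
  rw [htop, finrank_top]
  exact Nat.eq_sub_of_add_eq h

/-! ### Duality between min-plus and max-plus convexity -/

section Duality

open scoped Pointwise

variable {d : ℕ}

theorem isMaxConvex_iff_isMinConvex_neg {S : Set (TropTorus d)} :
    IsMaxConvex S ↔ IsMinConvex (-S) := by
  have key : ∀ (u w : Fin d → ℝ) (a b : ℝ),
      -tropClass (fun i => min (a + u i) (b + w i)) =
        tropClass (fun i => max (-a + (-u) i) (-b + (-w) i)) := by
    intro u w a b
    refine congrArg tropClass (funext fun i => ?_)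
    change -min (a + u i) (b + w i) = max (-a + -u i) (-b + -w i)
    rw [← max_neg_neg, neg_add, neg_add]
  constructor
  · intro h u w a b hu hw
    rw [Set.mem_neg, key]
    exact h (-u) (-w) (-a) (-b) hu hw
  · intro h u w a b hu hw
    have h1 := h (-u) (-w) (-a) (-b)
      (by rw [Set.mem_neg]; change tropClass (- -u) ∈ S; rwa [neg_neg])
      (by rw [Set.mem_neg]; change tropClass (- -w) ∈ S; rwa [neg_neg])
    rw [Set.mem_neg, key] at h1
    simpa only [neg_neg] using h1

theorem maxHull_eq_neg (S : Set (TropTorus d)) : maxHull S = -minHull (-S) := by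
  ext x
  simp only [maxHull, minHull, Set.mem_neg, Set.mem_sInter, Set.mem_ofPred_eq]
  constructor
  · intro h T hT
    refine h (-T) ⟨?_, ?_⟩
    · rw [isMaxConvex_iff_isMinConvex_neg, neg_neg]
      exact hT.1
    · rw [← Set.neg_subset_neg, neg_neg]
      exact hT.2
  · intro h T hT
    have := h (-T) ⟨isMaxConvex_iff_isMinConvex_neg.1 hT.1, Set.neg_subset_neg.2 hT.2⟩
    simpa using this

theorem maxVertices_eq_neg (S : Set (TropTorus d)) : maxVertices S = -minVertices (-S) := by
  ext x
  have h : -(S \ {x}) = -S \ {-x} := by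
    ext y
    simp [neg_eq_iff_eq_neg]
  simp only [maxVertices, minVertices, maxHull_eq_neg, h, Set.mem_neg, Set.mem_ofPred_eq, neg_neg]

theorem isMaxPlusSimplex_iff_neg {S : Set (TropTorus d)} :
    IsMaxPlusSimplex S ↔ IsMinPlusSimplex (-S) := by
  have h1 : interior (-S) = -interior S := by
    have := (Homeomorph.neg (TropTorus d)).preimage_interior S
    simpa using this.symm
  have h2 : (-minVertices (-S)).encard = (minVertices (-S)).encard := by
    rw [← Set.image_neg_eq_neg, neg_injective.encard_image]
  simp only [IsMaxPlusSimplex, IsMinPlusSimplex, maxVertices_eq_neg, maxHull_eq_neg, h1, h2,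
    Set.nonempty_neg, neg_neg, neg_eq_iff_eq_neg]

theorem polytrope_transpose (M : Matrix (Fin d) (Fin d) ℝ) : polytrope Mᵀ = -polytrope M := by
  ext x
  obtain ⟨u, rfl⟩ := tropClass_surjective x
  rw [Set.mem_neg]
  change _ ↔ tropClass (-u) ∈ _
  rw [tropClass_mem_polytrope, tropClass_mem_polytrope, forall_comm]
  refine forall_congr' fun i => forall_congr' fun j => ?_
  simp only [Matrix.transpose_apply, Pi.neg_apply]
  rw [neg_sub_neg]

theorem maxVertices_polytrope {M : Matrix (Fin d) (Fin d) ℝ} (hd : 0 < d) (h0 : ∀ i, M i i = 0)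
    (htri : ∀ i j k, M i k ≤ M i j + M j k) :
    maxVertices (polytrope M) = Set.range fun j => tropClass ((-Mᵀ).col j) := by
  rw [maxVertices_eq_neg, ← polytrope_transpose, minVertices_polytrope hd (by simpa using h0)
    fun i j k => by simpa [add_comm] using htri k j i]
  ext x
  simp only [Set.mem_neg, Set.mem_range]
  exact exists_congr fun j => ⟨fun h => by rw [← neg_neg x, ← h]; rfl, fun h => by
    rw [← h]; refine congrArg tropClass (funext fun i => ?_); simp⟩

theorem isMaxPlusSimplex_polytrope {M : Matrix (Fin d) (Fin d) ℝ} (hd : 0 < d)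
    (h0 : ∀ i, M i i = 0) (htri : ∀ i j k, M i k ≤ M i j + M j k)
    (hpos : ∀ i j, i ≠ j → 0 < M i j + M j i) : IsMaxPlusSimplex (polytrope M) := by
  rw [isMaxPlusSimplex_iff_neg, ← polytrope_transpose]
  exact isMinPlusSimplex_polytrope hd (by simpa using h0)
    (fun i j k => by simpa [add_comm] using htri k j i) fun i j hij => hpos j i hij.symm

end Duality

/-! ### Integral vertices -/

section Integral

variable {d : ℕ} {M : Matrix (Fin d) (Fin d) ℤ}

theorem realMatrix_diag (hM : realMatrix M ∈ polytropeRegion d) (i : Fin d) : M i i = 0 := by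
  have := hM.1 i
  simp only [realMatrix, Matrix.map_apply] at this
  exact_mod_cast this

theorem realMatrix_triangle (hM : realMatrix M ∈ polytropeRegion d) (i j k : Fin d) :
    M i k ≤ M i j + M j k := by
  have := polytropeRegion_triangle hM i j k
  simp only [realMatrix, Matrix.map_apply] at this
  exact_mod_cast this

theorem intClass_mem_polytrope {u : Fin d → ℤ} :
    intClass u ∈ polytrope (realMatrix M) ↔ ∀ i j, u i ≤ M i j + u j := by
  unfold intClass
  rw [tropClass_mem_polytrope]
  refine forall_congr' fun i => forall_congr' fun j => ?_
  simp only [realMatrix, Matrix.map_apply, sub_le_iff_le_add]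
  exact_mod_cast Iff.rfl

theorem intClass_mem_minVertices (hd : 0 < d) (hM : realMatrix M ∈ polytropeRegion d)
    {u : Fin d → ℤ} :
    intClass u ∈ minVertices (polytrope (realMatrix M)) ↔ ∃ j, ∀ i, u i = M i j + u j := by
  rw [minVertices_polytrope hd hM.1 (polytropeRegion_triangle hM)]
  refine exists_congr fun j => ?_
  rw [eq_comm, intClass, tropClass_eq_iff]
  simp only [realMatrix, Matrix.col_apply, Matrix.map_apply]
  constructor
  · rintro ⟨c, hc⟩ i
    have h1 := hc i
    have h2 := hc j
    rw [realMatrix_diag hM] at h2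
    have : (u i : ℝ) = M i j + u j := by push_cast at h2; linarith
    exact_mod_cast this
  · intro h
    exact ⟨u j, fun i => by rw [h i]; push_cast; ring⟩

theorem intClass_mem_maxVertices (hd : 0 < d) (hM : realMatrix M ∈ polytropeRegion d)
    {u : Fin d → ℤ} :
    intClass u ∈ maxVertices (polytrope (realMatrix M)) ↔ ∃ j, ∀ i, u i = u j - M j i := by
  rw [maxVertices_polytrope hd hM.1 (polytropeRegion_triangle hM)]
  refine exists_congr fun j => ?_
  rw [eq_comm, intClass, tropClass_eq_iff]
  simp only [realMatrix, Matrix.col_apply, Matrix.map_apply, Matrix.neg_apply,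
    Matrix.transpose_apply]
  constructor
  · rintro ⟨c, hc⟩ i
    have h1 := hc i
    have h2 := hc j
    rw [realMatrix_diag hM] at h2
    have : (u i : ℝ) = u j - M j i := by push_cast at h2; linarith
    exact_mod_cast this
  · intro h
    exact ⟨u j, fun i => by rw [h i]; push_cast; ring⟩

end Integral

/-! ### Valuations with values in `ℤ` -/

section Valuation

variable {K : Type u} [Field K] {v : AddValuation K (WithTop ℤ)}

theorem exists_int_le_val (v : AddValuation K (WithTop ℤ)) (x : K) :
    ∃ n : ℤ, (n : WithTop ℤ) ≤ v x := by
  induction h : v x using WithTop.recTopCoe with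
  | top => exact ⟨0, le_top⟩
  | coe a => exact ⟨a, le_rfl⟩

theorem exists_val_eq_int {x : K} (hx : x ≠ 0) : ∃ n : ℤ, v x = (n : WithTop ℤ) := by
  obtain ⟨n, hn⟩ := WithTop.ne_top_iff_exists.1 ((AddValuation.ne_top_iff v).2 hx)
  exact ⟨n, hn.symm⟩

theorem ne_zero_of_val_eq_int {x : K} {n : ℤ} (hx : v x = (n : WithTop ℤ)) : x ≠ 0 :=
  (AddValuation.ne_top_iff v).1 (by rw [hx]; exact WithTop.coe_ne_top)

theorem val_inv_eq_int {x : K} {n : ℤ} (hx : v x = (n : WithTop ℤ)) :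
    v x⁻¹ = ((-n : ℤ) : WithTop ℤ) := by
  have hx0 := ne_zero_of_val_eq_int hx
  obtain ⟨m, hm⟩ := exists_val_eq_int (v := v) (inv_ne_zero hx0)
  have h : v x + v x⁻¹ = 0 := by rw [← v.map_mul, mul_inv_cancel₀ hx0, v.map_one]
  rw [hm, hx] at h
  rw [hm]
  norm_cast at h ⊢
  lia

theorem le_val_mul {x y : K} {a b c : ℤ} (hx : (a : WithTop ℤ) ≤ v x) (hy : (b : WithTop ℤ) ≤ v y)
    (hc : c ≤ a + b) : (c : WithTop ℤ) ≤ v (x * y) := by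
  rw [v.map_mul]
  refine le_trans ?_ (add_le_add hx hy)
  exact_mod_cast hc

theorem le_val_div {x y : K} {a b c : ℤ} (hx : (a : WithTop ℤ) ≤ v x) (hy : v y = (b : WithTop ℤ))
    (hc : c ≤ a - b) : (c : WithTop ℤ) ≤ v (x / y) := by
  rw [div_eq_mul_inv]
  exact le_val_mul hx (val_inv_eq_int hy).ge (by lia)

theorem mem_valRing {x : K} : x ∈ valRing v ↔ ((0 : ℤ) : WithTop ℤ) ≤ v x := Iff.rfl

theorem exists_le_val_mul (hv : Function.Surjective v) (x y : K) (m n : ℤ) :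
    ∃ t : K, t ≠ 0 ∧ (m : WithTop ℤ) ≤ v (t * x) ∧ (n : WithTop ℤ) ≤ v (t * y) := by
  obtain ⟨a, ha⟩ := exists_int_le_val v x
  obtain ⟨b, hb⟩ := exists_int_le_val v y
  obtain ⟨t, ht⟩ := hv ((max (m - a) (n - b) : ℤ) : WithTop ℤ)
  exact ⟨t, ne_zero_of_val_eq_int ht, le_val_mul ht.ge ha (by lia), le_val_mul ht.ge hb (by lia)⟩

/-- If finitely many scalars sum to `1`, then one of them has valuation at most `0`. -/
theorem exists_val_le_zero_of_sum_eq_one {ι : Type*} [Fintype ι] {a : ι → K}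
    (ha : ∑ j, a j = 1) : ∃ j, v (a j) ≤ 0 := by
  by_contra! h
  have := v.map_lt_sum' (s := Finset.univ) (f := a) (g := 0) (by exact WithTop.coe_lt_top 0)
    fun j _ => h j
  rw [ha, v.map_one] at this
  exact lt_irrefl _ this

end Valuation

/-! ### Homomorphisms between modules over a graduated order -/

section GradOrder

variable {K : Type u} [Field K] {v : AddValuation K (WithTop ℤ)} {d : ℕ}
  {M : Matrix (Fin d) (Fin d) ℤ} {hM : realMatrix M ∈ polytropeRegion d}

/-- The multiple `c • E_ij` of a matrix unit, for `val c ≥ m_ij`, as an element of `Λ_M`. -/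
def gradUnit (hM : realMatrix M ∈ polytropeRegion d) (i j : Fin d) (c : K)
    (hc : (M i j : WithTop ℤ) ≤ v c) : gradOrder v M hM :=
  ⟨Matrix.single i j c, fun k l => by
    rw [Matrix.single_apply]
    split_ifs with h
    · rw [← h.1, ← h.2]; exact hc
    · rw [v.map_zero]; exact le_top⟩

theorem gradUnit_smul {i j : Fin d} {c : K} (hc : (M i j : WithTop ℤ) ≤ v c) (x : Fin d → K) :
    gradUnit hM i j c hc • x = Pi.single i (c * x j) := by
  change Matrix.single i j c *ᵥ x = _
  rw [Matrix.single_mulVec]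
  rfl

theorem mem_gradLattice {u : Fin d → ℤ} {hu : intClass u ∈ polytrope (realMatrix M)}
    {x : Fin d → K} : x ∈ gradLattice v M hM u hu ↔ ∀ i, (u i : WithTop ℤ) ≤ v (x i) := Iff.rfl

theorem single_mem_gradLattice {u : Fin d → ℤ} {hu : intClass u ∈ polytrope (realMatrix M)}
    {i : Fin d} {c : K} (hc : (u i : WithTop ℤ) ≤ v c) :
    Pi.single i c ∈ gradLattice v M hM u hu := by
  rw [mem_gradLattice]
  intro k
  rcases eq_or_ne k i with rfl | h
  · rwa [Pi.single_eq_same]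
  · rw [Pi.single_eq_of_ne h, v.map_zero]; exact le_top

theorem gradLattice_le {u w : Fin d → ℤ} {hu : intClass u ∈ polytrope (realMatrix M)}
    {hw : intClass w ∈ polytrope (realMatrix M)} (h : ∀ i, w i ≤ u i) :
    gradLattice v M hM u hu ≤ gradLattice v M hM w hw :=
  fun _ hx i => le_trans (by exact_mod_cast h i) (hx i)

/-- The action of `Λ_M` on a submodule of `K^d`. As a local instance, this and the two scalar tower
facts below cut short searches that are slow otherwise. -/
abbrev smulGradOrderSubmodule (L : Submodule (gradOrder v M hM) (Fin d → K)) :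
    SMul (gradOrder v M hM) L :=
  (Submodule.module L).toSMul

attribute [local instance] smulGradOrderSubmodule

theorem isScalarTowerGradOrderPi :
    IsScalarTower (valRing v) (gradOrder v M hM) (Fin d → K) :=
  inferInstance

attribute [local instance] isScalarTowerGradOrderPi

theorem isScalarTowerGradOrderSubmodule (L : Submodule (gradOrder v M hM) (Fin d → K)) :
    IsScalarTower (valRing v) (gradOrder v M hM) L :=
  inferInstance

attribute [local instance] isScalarTowerGradOrderSubmodule

/-- Two vectors `x`, `y` can be moved by matrix units to the same multiple of `e_j`, so a
`Λ_M`-homomorphism has proportional effects on all coordinates of all vectors. -/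
theorem coord_mul_hom_coord (hv : Function.Surjective v)
    {L L' : Submodule (gradOrder v M hM) (Fin d → K)} (f : L →ₗ[gradOrder v M hM] L')
    (x y : L) (i j : Fin d) :
    (y : Fin d → K) j * (f x : Fin d → K) i = (x : Fin d → K) i * (f y : Fin d → K) j := by
  obtain ⟨t, ht, h1, h2⟩ := exists_le_val_mul hv ((y : Fin d → K) j) ((x : Fin d → K) i)
    (M j i) (M j j)
  have hxy : (gradUnit hM j i _ h1 • x : L) = (gradUnit hM j j _ h2 • y : L) := by
    apply Subtype.ext
    rw [Submodule.coe_smul, Submodule.coe_smul, gradUnit_smul, gradUnit_smul]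
    congr 1
    ring
  have h := congrArg (fun z : L' => (z : Fin d → K) j) (congrArg f hxy)
  simp only [map_smul, Submodule.coe_smul, gradUnit_smul, Pi.single_eq_same, mul_assoc] at h
  exact mul_left_cancel₀ ht h

/-- Every `Λ_M`-homomorphism out of `L_u` is multiplication by a scalar of `K`. -/
theorem exists_scalar_of_hom (hv : Function.Surjective v) (hd : 0 < d) {u : Fin d → ℤ}
    {hu : intClass u ∈ polytrope (realMatrix M)}
    {L : Submodule (gradOrder v M hM) (Fin d → K)}
    (f : gradLattice v M hM u hu →ₗ[gradOrder v M hM] L) :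
    ∃ a : K, ∀ x i, (f x : Fin d → K) i = a * (x : Fin d → K) i := by
  obtain ⟨t, ht⟩ := hv (u ⟨0, hd⟩ : WithTop ℤ)
  have ht0 := ne_zero_of_val_eq_int ht
  let y : gradLattice v M hM u hu := ⟨Pi.single ⟨0, hd⟩ t, single_mem_gradLattice ht.ge⟩
  refine ⟨(f y : Fin d → K) ⟨0, hd⟩ / t, fun x i => ?_⟩
  have h := coord_mul_hom_coord hv f x y i ⟨0, hd⟩
  have hy : (y : Fin d → K) ⟨0, hd⟩ = t := by
    change (Pi.single ⟨0, hd⟩ t : Fin d → K) ⟨0, hd⟩ = t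
    rw [Pi.single_eq_same]
  rw [hy] at h
  field_simp
  rw [mul_comm, h, mul_comm]

/-- A scalar of valuation at most `0` that maps `L_u` into `L_w` forces `L_u ⊆ L_w`. -/
theorem le_of_scalar_hom (hv : Function.Surjective v) {u w : Fin d → ℤ}
    {hu : intClass u ∈ polytrope (realMatrix M)} {hw : intClass w ∈ polytrope (realMatrix M)}
    (f : gradLattice v M hM u hu →ₗ[gradOrder v M hM] gradLattice v M hM w hw) {a : K}
    (hf : ∀ x i, (f x : Fin d → K) i = a * (x : Fin d → K) i) (ha : v a ≤ 0) (i : Fin d) :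
    w i ≤ u i := by
  obtain ⟨t, ht⟩ := hv (u i : WithTop ℤ)
  have h := (f ⟨Pi.single i t, single_mem_gradLattice ht.ge⟩).2 i
  rw [hf, v.map_mul] at h
  change _ ≤ v a + v ((Pi.single i t : Fin d → K) i) at h
  rw [Pi.single_eq_same, ht] at h
  have h2 := h.trans (add_le_add_left ha _)
  rw [zero_add] at h2
  exact_mod_cast h2

/-! ### Lattices stable under a graduated order -/

theorem exists_int_le_val_of_fg {N : Submodule (valRing v) (Fin d → K)} (hN : N.FG) :
    ∃ n : ℤ, N ≤ diagLattice v fun _ => n := by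
  have hanti : ∀ m n : ℤ, m ≤ n →
      diagLattice v (fun _ : Fin d => n) ≤ diagLattice v fun _ => m :=
    fun m n hmn x hx i => le_trans (by exact_mod_cast hmn) (hx i)
  induction N, hN using Submodule.fg_induction with
  | singleton x =>
    choose n hn using fun i => exists_int_le_val v (x i)
    obtain ⟨m, hm⟩ := Finite.bddBelow_range n
    refine ⟨m, ?_⟩
    rw [Submodule.span_singleton_le_iff_mem]
    exact fun i => le_trans (by exact_mod_cast hm ⟨i, rfl⟩) (hn i)
  | sup N₁ N₂ _ _ h₁ h₂ =>
    obtain ⟨m, hm⟩ := h₁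
    obtain ⟨n, hn⟩ := h₂
    exact ⟨min m n, sup_le (hm.trans (hanti _ _ (min_le_left _ _)))
      (hn.trans (hanti _ _ (min_le_right _ _)))⟩

/-- Every lattice stable under `Λ_M` is one of the `L_u`: the diagonal matrix units lie in `Λ_M`,
so the lattice is the direct sum of its coordinate parts. -/
theorem exists_eq_gradLattice (hv : Function.Surjective v)
    {L : Submodule (gradOrder v M hM) (Fin d → K)}
    (hL : (L.restrictScalars (valRing v)).IsLattice K) :
    ∃ (u : Fin d → ℤ) (hu : intClass u ∈ polytrope (realMatrix M)),
      L = gradLattice v M hM u hu := by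
  obtain ⟨n, hn⟩ := exists_int_le_val_of_fg hL.fg
  have hne : ∀ i, ∃ x ∈ L, x i ≠ 0 := by
    intro i
    by_contra! h
    have h1 : Submodule.span K ((L.restrictScalars (valRing v) : Set (Fin d → K))) ≤
        LinearMap.ker (LinearMap.proj i : (Fin d → K) →ₗ[K] K) :=
      Submodule.span_le.2 fun x hx => h x hx
    rw [hL.span_eq_top] at h1
    have h2 := h1 (x := Pi.single i 1) Submodule.mem_top
    simp at h2
  -- `u i` is the least valuation of an `i`-th coordinate of a vector in `L`
  have hmin : ∀ i, ∃ m : ℤ, (∃ x ∈ L, v (x i) = m) ∧ ∀ k : ℤ, (∃ x ∈ L, v (x i) = k) → m ≤ k := by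
    intro i
    refine Int.exists_least_of_bdd ⟨n, ?_⟩ ?_
    · rintro k ⟨x, hx, hk⟩
      have := hn hx i
      rw [hk] at this
      exact_mod_cast this
    · obtain ⟨x, hx, hxi⟩ := hne i
      obtain ⟨k, hk⟩ := exists_val_eq_int (v := v) hxi
      exact ⟨k, x, hx, hk⟩
  choose u hu using hmin
  choose x hx hxu using fun i => (hu i).1
  have hle : ∀ y ∈ L, ∀ i, (u i : WithTop ℤ) ≤ v (y i) := by
    intro y hy i
    by_cases h0 : y i = 0
    · rw [h0, v.map_zero]; exact le_top
    · obtain ⟨k, hk⟩ := exists_val_eq_int (v := v) h0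
      rw [hk]
      exact_mod_cast (hu i).2 k ⟨y, hy, hk⟩
  have hsingle : ∀ i j (c : K), (M i j : WithTop ℤ) ≤ v c → Pi.single i (c * x j j) ∈ L := by
    intro i j c hc
    rw [← gradUnit_smul (hM := hM) hc]
    exact L.smul_mem _ (hx j)
  have hstable : intClass u ∈ polytrope (realMatrix M) := by
    rw [intClass_mem_polytrope]
    intro i j
    obtain ⟨c, hc⟩ := hv (M i j : WithTop ℤ)
    have h := hle _ (hsingle i j c hc.ge) i
    rw [Pi.single_eq_same, v.map_mul, hc, hxu] at h
    exact_mod_cast h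
  refine ⟨u, hstable, le_antisymm hle fun y hy => ?_⟩
  rw [← Finset.univ_sum_single y]
  refine L.sum_mem fun i _ => ?_
  have h := hsingle i i (y i / x i i)
    (le_val_div (hy i) (hxu i) (by rw [realMatrix_diag hM]; lia))
  rwa [div_mul_cancel₀ _ (ne_zero_of_val_eq_int (hxu i))] at h

end GradOrder

/-! ### Projective lattices -/

section Projective

variable {K : Type u} [Field K] {v : AddValuation K (WithTop ℤ)} {d : ℕ}
  {M : Matrix (Fin d) (Fin d) ℤ} {hM : realMatrix M ∈ polytropeRegion d}

attribute [local instance] smulGradOrderSubmodule isScalarTowerGradOrderPi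
  isScalarTowerGradOrderSubmodule

/-- If `u` is a translate of the `j`-th column of `M`, then `L_u` is isomorphic to `Λ_M e_jj`, the
set of `j`-th columns of matrices in `Λ_M`, which is a direct summand of `Λ_M`. -/
theorem projective_gradLattice_of_col (hv : Function.Surjective v) {u : Fin d → ℤ}
    {hu : intClass u ∈ polytrope (realMatrix M)} {j : Fin d} (hj : ∀ i, u i = M i j + u j) :
    Module.Projective (gradOrder v M hM) (gradLattice v M hM u hu) := by
  obtain ⟨a, ha⟩ := hv (u j : WithTop ℤ)
  have ha0 := ne_zero_of_val_eq_int ha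
  let i : gradLattice v M hM u hu →ₗ[gradOrder v M hM] gradOrder v M hM :=
    { toFun := fun x => ⟨Matrix.vecMulVec x (Pi.single j a⁻¹), fun k l => by
        rw [Matrix.vecMulVec_apply]
        rcases eq_or_ne l j with rfl | h
        · rw [Pi.single_eq_same]
          exact le_val_mul (x.2 k) (val_inv_eq_int ha).ge (by have := hj k; lia)
        · rw [Pi.single_eq_of_ne h, mul_zero, v.map_zero]
          exact le_top⟩
      map_add' := fun x y => Subtype.ext (Matrix.add_vecMulVec _ _ _)
      map_smul' := fun Z x =>
        Subtype.ext (Matrix.mul_vecMulVec (Z : Matrix (Fin d) (Fin d) K) _ _).symm }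
  let s : gradOrder v M hM →ₗ[gradOrder v M hM] gradLattice v M hM u hu :=
    LinearMap.toSpanSingleton _ _ ⟨Pi.single j a, single_mem_gradLattice ha.ge⟩
  refine Module.Projective.of_split i s (LinearMap.ext fun x => Subtype.ext ?_)
  change Matrix.vecMulVec (x : Fin d → K) (Pi.single j a⁻¹) *ᵥ Pi.single j a = x
  rw [Matrix.vecMulVec_mulVec]
  ext k
  simp [ha0]

/-- The sum of the inclusions of the lattices `p^{u_j} Λ_M e_j ⊆ L_u` is surjective. If it splits,
the splitting consists of scalars with sum `1`, and one of them is a unit, so that one of these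
lattices is all of `L_u`. -/
theorem exists_col_of_projective (hv : Function.Surjective v) (hd : 0 < d) {u : Fin d → ℤ}
    {hu : intClass u ∈ polytrope (realMatrix M)}
    (h : Module.Projective (gradOrder v M hM) (gradLattice v M hM u hu)) :
    ∃ j, ∀ i, u i = M i j + u j := by
  have hu' := intClass_mem_polytrope.1 hu
  have hw : ∀ j, intClass (fun i => M i j + u j) ∈ polytrope (realMatrix M) := fun j =>
    intClass_mem_polytrope.2 fun i k => by have := realMatrix_triangle hM i k j; lia
  have hle : ∀ j, gradLattice v M hM _ (hw j) ≤ gradLattice v M hM u hu := fun j =>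
    gradLattice_le fun i => hu' i j
  let π : (∀ j, gradLattice v M hM _ (hw j)) →ₗ[gradOrder v M hM] gradLattice v M hM u hu :=
    ∑ j, Submodule.inclusion (hle j) ∘ₗ LinearMap.proj j
  have hπ : ∀ y i, (π y : Fin d → K) i = ∑ j, (y j : Fin d → K) i := by
    intro y i
    simp only [π, LinearMap.sum_apply, LinearMap.comp_apply, LinearMap.proj_apply,
      Submodule.coe_sum, Submodule.coe_inclusion, Finset.sum_apply]
  have hsurj : Function.Surjective π := by
    intro x
    refine ⟨fun j => ⟨Pi.single j ((x : Fin d → K) j), single_mem_gradLattice ?_⟩, ?_⟩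
    · rw [realMatrix_diag hM, zero_add]
      exact x.2 j
    · refine Subtype.ext (funext fun i => ?_)
      rw [hπ]
      exact Finset.sum_pi_single i (x : Fin d → K) Finset.univ |>.trans (by simp)
  obtain ⟨s, hs⟩ := Module.projective_lifting_property π LinearMap.id hsurj
  choose a ha using fun j => exists_scalar_of_hom hv hd (LinearMap.proj j ∘ₗ s)
  have hsum : ∑ j, a j = 1 := by
    obtain ⟨t, ht⟩ := hv (u ⟨0, hd⟩ : WithTop ℤ)
    have h1 := congrArg (fun z : gradLattice v M hM u hu => (z : Fin d → K) ⟨0, hd⟩)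
      (LinearMap.congr_fun hs ⟨Pi.single ⟨0, hd⟩ t, single_mem_gradLattice ht.ge⟩)
    simp only [LinearMap.comp_apply, hπ] at h1
    have h2 := h1.symm.trans (Finset.sum_congr rfl fun j _ => ha j _ _)
    simp only [LinearMap.id_apply, Pi.single_eq_same, ← Finset.sum_mul] at h2
    exact (mul_right_cancel₀ (ne_zero_of_val_eq_int ht) ((one_mul t).trans h2)).symm
  obtain ⟨j, hj⟩ := exists_val_le_zero_of_sum_eq_one hsum
  exact ⟨j, fun i => le_antisymm (hu' i j) (le_of_scalar_hom hv _ (ha j) hj i)⟩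

end Projective

/-! ### Injective lattices -/

section Injective

/-- A linear map on the source of a split embedding extends to the target. -/
theorem exists_extend_of_exact {R X Y Q N : Type*} [CommRing R]
    [AddCommGroup X] [AddCommGroup Y] [AddCommGroup Q] [AddCommGroup N]
    [Module R X] [Module R Y] [Module R Q] [Module R N] [Module.Free R Q]
    {f : X →ₗ[R] Y} {q : Y →ₗ[R] Q} (hf : Function.Injective f) (hq : Function.Surjective q)
    (hfq : Function.Exact f q) (φ : X →ₗ[R] N) : ∃ γ : Y →ₗ[R] N, ∀ x, γ (f x) = φ x := by
  obtain ⟨l, hl⟩ := Module.projective_lifting_property q LinearMap.id hq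
  obtain ⟨r, hr⟩ := ((Function.Exact.split_tfae' hfq).out 0 1 :).1 ⟨hf, l, hl⟩ |>.2
  exact ⟨φ ∘ₗ r, fun x => congrArg φ (LinearMap.congr_fun hr x)⟩

theorem exists_extend_of_free_quotient {R Λ X Y N : Type*} [CommRing R] [Ring Λ] [Algebra R Λ]
    [AddCommGroup X] [AddCommGroup Y] [AddCommGroup N] [Module R X] [Module R Y] [Module R N]
    [Module Λ X] [Module Λ Y] [IsScalarTower R Λ X] [IsScalarTower R Λ Y] (f : X →ₗ[Λ] Y)
    (hf : Function.Injective f) (hfree : Module.Free R (Y ⧸ LinearMap.range f)) (φ : X →ₗ[R] N) :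
    ∃ γ : Y →ₗ[R] N, ∀ x, γ (f x) = φ x :=
  exists_extend_of_exact (f := f.restrictScalars R)
    (q := (LinearMap.range f).mkQ.restrictScalars R) hf
    (Submodule.mkQ_surjective (LinearMap.range f))
    (fun _ => Submodule.Quotient.mk_eq_zero (LinearMap.range f)) φ

/-- An injective lattice is a direct summand of every lattice that contains it as a pure
submodule: over a local Bézout domain, purity makes the cokernel free. -/
theorem IsInjectiveLattice.exists_retraction {R Λ L Y : Type u} [CommRing R] [IsDomain R]
    [IsBezout R] [IsLocalRing R] [Ring Λ] [Algebra R Λ] [AddCommGroup L] [Module R L] [Module Λ L]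
    [IsScalarTower R Λ L] (hL : IsInjectiveLattice R Λ L) [AddCommGroup Y] [Module R Y] [Module Λ Y]
    [IsScalarTower R Λ Y] [Module.Finite R Y] [Module.Free R Y] (f : L →ₗ[Λ] Y)
    (hf : Function.Injective f)
    (hpure : ∀ (c : R) (y : Y), c ≠ 0 → c • y ∈ LinearMap.range f → y ∈ LinearMap.range f) :
    ∃ s : Y →ₗ[Λ] L, ∀ x, s (f x) = x := by
  have := hL.1
  have := hL.2.1
  have : Module.Finite R (Y ⧸ LinearMap.range f) :=
    Module.Finite.of_surjective ((LinearMap.range f).mkQ.restrictScalars R)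
      (Submodule.mkQ_surjective (LinearMap.range f))
  have : Module.Flat R (Y ⧸ LinearMap.range f) := by
    rw [Module.Flat.flat_iff_torsion_eq_bot_of_isBezout, eq_bot_iff]
    rintro q ⟨⟨c, hc⟩, hcq⟩
    obtain ⟨y, rfl⟩ := Submodule.mkQ_surjective (LinearMap.range f) q
    exact (Submodule.Quotient.mk_eq_zero (LinearMap.range f)).2
      (hpure c y (nonZeroDivisors.ne_zero hc)
        ((Submodule.Quotient.mk_eq_zero (LinearMap.range f)).1 hcq))
  obtain ⟨s, hs⟩ := hL.2.2 _ _ f hf Module.free_of_flat_of_isLocalRing LinearMap.id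
  exact ⟨s, LinearMap.congr_fun hs⟩

/-- Given a jointly injective family of homomorphisms from an injective lattice `L` to lattices
`N j`, with pure image in their product, the identity of `L` is a sum of endomorphisms that factor
through the `N j`. -/
theorem IsInjectiveLattice.exists_sum_comp_eq {R Λ L : Type u} {ι : Type} [Fintype ι]
    [DecidableEq ι] {N : ι → Type u} [CommRing R] [IsDomain R] [IsBezout R] [IsLocalRing R] [Ring Λ]
    [Algebra R Λ] [AddCommGroup L] [Module R L] [Module Λ L] [IsScalarTower R Λ L]
    (hL : IsInjectiveLattice R Λ L) [∀ j, AddCommGroup (N j)] [∀ j, Module R (N j)]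
    [∀ j, Module Λ (N j)] [∀ j, IsScalarTower R Λ (N j)] [∀ j, Module.Finite R (N j)]
    [∀ j, Module.Free R (N j)] (f : ∀ j, L →ₗ[Λ] N j)
    (hf : ∀ x y, (∀ j, f j x = f j y) → x = y)
    (hpure : ∀ (c : R) (y : ∀ j, N j) (x : L), c ≠ 0 → (∀ j, f j x = c • y j) →
      ∃ z, ∀ j, f j z = y j) :
    ∃ s : ∀ j, N j →ₗ[Λ] L, ∀ x, ∑ j, s j (f j x) = x := by
  obtain ⟨s, hs⟩ := hL.exists_retraction (LinearMap.pi f)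
    (fun x y h => hf x y (fun j => congrFun h j))
    (fun c y hc ⟨x, hx⟩ =>
      let ⟨z, hz⟩ := hpure c y x hc (fun j => congrFun hx j)
      ⟨z, funext hz⟩)
  refine ⟨fun j => s ∘ₗ LinearMap.single Λ N j, fun x => ?_⟩
  refine Eq.trans ?_ (hs x)
  rw [← Finset.univ_sum_single (LinearMap.pi f x), map_sum]
  rfl

variable {K : Type u} [Field K] {v : AddValuation K (WithTop ℤ)} {d : ℕ}
  {M : Matrix (Fin d) (Fin d) ℤ} {hM : realMatrix M ∈ polytropeRegion d}

attribute [local instance] smulGradOrderSubmodule isScalarTowerGradOrderPi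
  isScalarTowerGradOrderSubmodule

theorem finite_free_gradLattice (hv : Function.Surjective v) (u : Fin d → ℤ)
    (hu : intClass u ∈ polytrope (realMatrix M)) :
    Module.Finite (valRing v) (gradLattice v M hM u hu) ∧
      Module.Free (valRing v) (gradLattice v M hM u hu) := by
  choose t ht using fun i => hv (u i : WithTop ℤ)
  have ht0 := fun i => ne_zero_of_val_eq_int (ht i)
  let e : (Fin d → valRing v) ≃ₗ[valRing v] gradLattice v M hM u hu :=
    { toFun := fun y => ⟨fun i => t i * y i, fun i =>
        le_val_mul (ht i).ge (mem_valRing.1 (y i).2) (by lia)⟩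
      invFun := fun x i => ⟨(x : Fin d → K) i / t i,
        mem_valRing.2 (le_val_div (x.2 i) (ht i) (by lia))⟩
      map_add' := fun x y => Subtype.ext (funext fun i => mul_add _ _ _)
      map_smul' := fun c x => Subtype.ext (funext fun i => mul_left_comm _ _ _)
      left_inv := fun y => funext fun i => Subtype.ext (mul_div_cancel_left₀ _ (ht0 i))
      right_inv := fun x => Subtype.ext (funext fun i => mul_div_cancel₀ _ (ht0 i)) }
  exact ⟨Module.Finite.equiv e, Module.Free.of_equiv e⟩

theorem mul_div_mem_valRing (hM : realMatrix M ∈ polytropeRegion d) {j : Fin d} {r : Fin d → K}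
    (hr : ∀ i, v (r i) = (M j i : WithTop ℤ)) (Z : gradOrder v M hM) (i k : Fin d) :
    r i * (Z : Matrix (Fin d) (Fin d) K) i k / r k ∈ valRing v :=
  mem_valRing.2 (le_val_div (le_val_mul (hr i).ge (Z.2 i k) le_rfl) (hr k)
    (by have := realMatrix_triangle hM j i k; lia))

theorem gradUnit_mul {j : Fin d} {r : Fin d → K} (hr : ∀ i, v (r i) = (M j i : WithTop ℤ))
    (Z : gradOrder v M hM) (i : Fin d) :
    gradUnit hM j i (r i) (hr i).ge * Z =
      ∑ k, (⟨_, mul_div_mem_valRing hM hr Z i k⟩ : valRing v) •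
        gradUnit hM j k (r k) (hr k).ge := by
  apply Subtype.ext
  rw [AddSubmonoidClass.coe_finsetSum]
  change Matrix.single j i (r i) * (Z : Matrix (Fin d) (Fin d) K) =
    ∑ k, (⟨_, mul_div_mem_valRing hM hr Z i k⟩ : valRing v) • Matrix.single j k (r k)
  ext a b
  rw [Matrix.sum_apply, Finset.sum_eq_single b]
  · change _ = r i * (Z : Matrix (Fin d) (Fin d) K) i b / r b * Matrix.single j b (r b) a b
    have := ne_zero_of_val_eq_int (hr b)
    rcases eq_or_ne a j with rfl | h
    · simp [this]
    · simp [h, h.symm]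
  · intro k _ hk
    change r i * (Z : Matrix (Fin d) (Fin d) K) i k / r k * Matrix.single j k (r k) a b = 0
    simp [hk]
  · simp

/-- If `-u` is a translate of the `j`-th row of `M`, then each `𝒪_K`-linear form `γ` on a
`Λ_M`-module is, up to a scalar, the `j`-th coordinate of the homomorphism into `L_u` whose
coordinates are multiples of `y ↦ γ (E_ji y)`. -/
theorem exists_hom_of_linearForm {u : Fin d → ℤ} (hu : intClass u ∈ polytrope (realMatrix M))
    {j : Fin d} (hj : ∀ i, u i = u j - M j i) {a : K} (ha : v a = (u j : WithTop ℤ)) {r : Fin d → K}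
    (hr : ∀ i, v (r i) = (M j i : WithTop ℤ)) {Y : Type*} [AddCommGroup Y]
    [Module (valRing v) Y] [Module (gradOrder v M hM) Y]
    [IsScalarTower (valRing v) (gradOrder v M hM) Y] (γ : Y →ₗ[valRing v] valRing v) :
    ∃ h : Y →ₗ[gradOrder v M hM] gradLattice v M hM u hu,
      ∀ y i, (h y : Fin d → K) i =
        a / r i * (γ (gradUnit hM j i (r i) (hr i).ge • y) : K) := by
  have hr0 := fun i => ne_zero_of_val_eq_int (hr i)
  have hmem : ∀ y, (fun i => a / r i * (γ (gradUnit hM j i (r i) (hr i).ge • y) : K)) ∈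
      gradLattice v M hM u hu := fun y i =>
    le_val_mul (le_val_div ha.ge (hr i) le_rfl)
      (mem_valRing.1 (γ (gradUnit hM j i (r i) (hr i).ge • y)).2) (by have := hj i; lia)
  have hadd : ∀ x y i, a / r i * (γ (gradUnit hM j i (r i) (hr i).ge • (x + y)) : K) =
      a / r i * (γ (gradUnit hM j i (r i) (hr i).ge • x) : K) +
        a / r i * (γ (gradUnit hM j i (r i) (hr i).ge • y) : K) := by
    intro x y i
    rw [smul_add, map_add, ← mul_add]
    rfl
  have hsmul : ∀ (Z : gradOrder v M hM) y i,
      a / r i * (γ (gradUnit hM j i (r i) (hr i).ge • Z • y) : K) =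
        ∑ k, (Z : Matrix (Fin d) (Fin d) K) i k *
          (a / r k * (γ (gradUnit hM j k (r k) (hr k).ge • y) : K)) := by
    intro Z y i
    have h1 : γ (gradUnit hM j i (r i) (hr i).ge • Z • y) =
        ∑ k, (⟨_, mul_div_mem_valRing hM hr Z i k⟩ : valRing v) *
          γ (gradUnit hM j k (r k) (hr k).ge • y) := by
      rw [← mul_smul, gradUnit_mul hr, Finset.sum_smul, map_sum]
      refine Finset.sum_congr rfl fun k _ => ?_
      rw [smul_assoc, map_smul, smul_eq_mul]
    rw [h1, AddSubmonoidClass.coe_finsetSum, Finset.mul_sum]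
    refine Finset.sum_congr rfl fun k _ => ?_
    rw [MulMemClass.coe_mul]
    have := hr0 i
    have := hr0 k
    field_simp
  exact ⟨{ toFun := fun y => ⟨_, hmem y⟩
           map_add' := fun x y => Subtype.ext (funext (hadd x y))
           map_smul' := fun Z y => Subtype.ext (funext (hsmul Z y)) }, fun _ _ => rfl⟩

/-- If `-u` is a translate of the `j`-th row of `M`, then `L_u` is the `𝒪_K`-dual of the projective
right module `e_jj Λ_M`: a homomorphism into `L_u` is determined by its `j`-th coordinate, which may
be any `𝒪_K`-linear form, so extending homomorphisms amounts to extending linear forms. -/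
theorem isInjectiveLattice_gradLattice_of_row (hv : Function.Surjective v) {u : Fin d → ℤ}
    {hu : intClass u ∈ polytrope (realMatrix M)} {j : Fin d} (hj : ∀ i, u i = u j - M j i) :
    IsInjectiveLattice (valRing v) (gradOrder v M hM) (gradLattice v M hM u hu) := by
  refine ⟨(finite_free_gradLattice hv u hu).1, (finite_free_gradLattice hv u hu).2, ?_⟩
  intro X Y _ _ _ _ _ _ _ _ _ _ _ _ f hf hfree g
  obtain ⟨a, ha⟩ := hv (u j : WithTop ℤ)
  have ha0 := ne_zero_of_val_eq_int ha
  choose r hr using fun i => hv (M j i : WithTop ℤ)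
  let φ : gradLattice v M hM u hu →ₗ[valRing v] valRing v :=
    { toFun := fun y => ⟨(y : Fin d → K) j / a, mem_valRing.2 (le_val_div (y.2 j) ha (by lia))⟩
      map_add' := fun x y => Subtype.ext (add_div _ _ _)
      map_smul' := fun c x => Subtype.ext (mul_div_assoc (c : K) _ _) }
  have hφ : ∀ y, (φ y : K) = (y : Fin d → K) j / a := fun _ => rfl
  obtain ⟨γ, hγ⟩ := exists_extend_of_free_quotient f hf hfree (φ ∘ₗ g.restrictScalars (valRing v))
  obtain ⟨h, hh⟩ := exists_hom_of_linearForm (hM := hM) hu hj ha hr γ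
  refine ⟨h, LinearMap.ext fun x => Subtype.ext (funext fun i => ?_)⟩
  rw [LinearMap.comp_apply, hh, ← map_smul, hγ, LinearMap.comp_apply,
    LinearMap.restrictScalars_apply, hφ, map_smul, Submodule.coe_smul,
    gradUnit_smul, Pi.single_eq_same]
  have := ne_zero_of_val_eq_int (hr i)
  field_simp

/-- The lattice `L_u` is the intersection of the lattices `L_w`, where `-w` runs through translates
of the rows of `M`, and its diagonal embedding into their product has a torsion-free cokernel. If
this embedding splits, the splitting consists of scalars with sum `1`, and one of them is a unit, so
that one of these lattices equals `L_u`. -/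
theorem exists_row_of_isInjectiveLattice (hv : Function.Surjective v) (hd : 0 < d) {u : Fin d → ℤ}
    {hu : intClass u ∈ polytrope (realMatrix M)}
    (h : IsInjectiveLattice (valRing v) (gradOrder v M hM) (gradLattice v M hM u hu)) :
    ∃ j, ∀ i, u i = u j - M j i := by
  have hu' := intClass_mem_polytrope.1 hu
  have hw : ∀ j, intClass (fun i => u j - M j i) ∈ polytrope (realMatrix M) := fun j =>
    intClass_mem_polytrope.2 fun i k => by have := realMatrix_triangle hM j i k; lia
  have hle : ∀ j, gradLattice v M hM u hu ≤ gradLattice v M hM _ (hw j) := fun j =>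
    gradLattice_le fun i => by have := hu' j i; lia
  have hfin : ∀ j, Module.Finite (valRing v) (gradLattice v M hM _ (hw j)) := fun j =>
    (finite_free_gradLattice hv _ _).1
  have hfree : ∀ j, Module.Free (valRing v) (gradLattice v M hM _ (hw j)) := fun j =>
    (finite_free_gradLattice hv _ _).2
  obtain ⟨s, hs⟩ := h.exists_sum_comp_eq (fun j => Submodule.inclusion (hle j))
    (fun x y hxy => Submodule.inclusion_injective (hle ⟨0, hd⟩) (hxy ⟨0, hd⟩)) (by
      intro c y x hc hx
      have hc0 : (c : K) ≠ 0 := fun h0 => hc (Subtype.ext h0)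
      have hxy : ∀ j i, (x : Fin d → K) i = c * (y j : Fin d → K) i := fun j i =>
        congrFun (congrArg Subtype.val (hx j)) i
      -- the `i`-th coordinate of the common value is bounded by membership in the `i`-th factor
      have hz : (y ⟨0, hd⟩ : Fin d → K) ∈ gradLattice v M hM u hu := by
        intro i
        rw [mul_left_cancel₀ hc0 ((hxy ⟨0, hd⟩ i).symm.trans (hxy i i))]
        have : ((u i - M i i : ℤ) : WithTop ℤ) ≤ _ := (y i).2 i
        rwa [realMatrix_diag hM, sub_zero] at this
      exact ⟨⟨_, hz⟩, fun j => Subtype.ext (funext fun i =>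
        mul_left_cancel₀ hc0 ((hxy ⟨0, hd⟩ i).symm.trans (hxy j i)))⟩)
  choose a ha using fun j => exists_scalar_of_hom hv hd (s j)
  have hsum : ∑ j, a j = 1 := by
    obtain ⟨t, ht⟩ := hv (u ⟨0, hd⟩ : WithTop ℤ)
    let x : gradLattice v M hM u hu := ⟨Pi.single ⟨0, hd⟩ t, single_mem_gradLattice ht.ge⟩
    have hx : (x : Fin d → K) ⟨0, hd⟩ = t := by
      change (Pi.single ⟨0, hd⟩ t : Fin d → K) ⟨0, hd⟩ = t
      rw [Pi.single_eq_same]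
    have h2 := congrFun (congrArg Subtype.val (hs x)) ⟨0, hd⟩
    rw [AddSubmonoidClass.coe_finsetSum, Finset.sum_apply, hx] at h2
    have h3 := h2.symm.trans (Finset.sum_congr rfl fun j _ => ha j _ ⟨0, hd⟩)
    simp only [Submodule.coe_inclusion, hx, ← Finset.sum_mul] at h3
    exact (mul_right_cancel₀ (ne_zero_of_val_eq_int ht) ((one_mul t).trans h3)).symm
  obtain ⟨j, hj⟩ := exists_val_le_zero_of_sum_eq_one hsum
  refine ⟨j, fun i => le_antisymm (le_of_scalar_hom hv _ (ha j) hj i) ?_⟩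
  have := hu' j i
  lia

end Injective

/-! ### Vertices and projective or injective lattices -/

theorem theorem4p2 {K : Type u} [Field K] (v : AddValuation K (WithTop ℤ))
    (hv : Function.Surjective v) (d : ℕ) (hd : 0 < d) :
    (∀ M : Matrix (Fin d) (Fin d) ℝ, M ∈ polytropeRegion d → IsStandardForm M →
      Module.finrank ℝ (vectorSpan ℝ (polytrope M)) = d - 1 ∧
      IsMinPlusSimplex (polytrope M) ∧
      IsMaxPlusSimplex (polytrope M) ∧
      minVertices (polytrope M) = Set.range (fun j => tropClass (M.col j)) ∧
      maxVertices (polytrope M) = Set.range (fun j => tropClass ((-Mᵀ).col j))) ∧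
    (∀ (M : Matrix (Fin d) (Fin d) ℤ) (hM : realMatrix M ∈ polytropeRegion d),
      IsStandardForm (realMatrix M) →
      (∀ (u : Fin d → ℤ) (hu : intClass u ∈ polytrope (realMatrix M)),
        (intClass u ∈ minVertices (polytrope (realMatrix M)) ↔
          Module.Projective (gradOrder v M hM) (gradLattice v M hM u hu)) ∧
        (intClass u ∈ maxVertices (polytrope (realMatrix M)) ↔
          IsInjectiveLattice (valRing v) (gradOrder v M hM) (gradLattice v M hM u hu))) ∧
      (∀ L : Submodule (gradOrder v M hM) (Fin d → K),
        (L.restrictScalars (valRing v)).IsLattice K →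
        (Module.Projective (gradOrder v M hM) L ↔
          ∃ (u : Fin d → ℤ) (hu : intClass u ∈ polytrope (realMatrix M)),
            intClass u ∈ minVertices (polytrope (realMatrix M)) ∧ L = gradLattice v M hM u hu) ∧
        (IsInjectiveLattice (valRing v) (gradOrder v M hM) L ↔
          ∃ (u : Fin d → ℤ) (hu : intClass u ∈ polytrope (realMatrix M)),
            intClass u ∈ maxVertices (polytrope (realMatrix M)) ∧ L = gradLattice v M hM u hu))) := by
  refine ⟨fun M hM hstd => ?_, fun M hM _ => ⟨fun u hu => ⟨?_, ?_⟩, fun L hL => ⟨?_, ?_⟩⟩⟩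
  · have htri := polytropeRegion_triangle hM
    have hmin := isMinPlusSimplex_polytrope hd hM.1 htri hstd.2
    exact ⟨finrank_vectorSpan_of_interior_nonempty hd hmin.1, hmin,
      isMaxPlusSimplex_polytrope hd hM.1 htri hstd.2, minVertices_polytrope hd hM.1 htri,
      maxVertices_polytrope hd hM.1 htri⟩
  · rw [intClass_mem_minVertices hd hM]
    exact ⟨fun ⟨_, hj⟩ => projective_gradLattice_of_col hv hj,
      fun h => exists_col_of_projective hv hd h⟩
  · rw [intClass_mem_maxVertices hd hM]
    exact ⟨fun ⟨_, hj⟩ => isInjectiveLattice_gradLattice_of_row hv hj,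
      fun h => exists_row_of_isInjectiveLattice hv hd h⟩
  · simp only [intClass_mem_minVertices hd hM]
    constructor
    · intro h
      obtain ⟨u, hu, rfl⟩ := exists_eq_gradLattice hv hL
      exact ⟨u, hu, exists_col_of_projective hv hd h, rfl⟩
    · rintro ⟨u, hu, ⟨j, hj⟩, rfl⟩
      exact projective_gradLattice_of_col hv hj
  · simp only [intClass_mem_maxVertices hd hM]
    constructor
    · intro h
      obtain ⟨u, hu, rfl⟩ := exists_eq_gradLattice hv hL
      exact ⟨u, hu, exists_row_of_isInjectiveLattice hv hd h, rfl⟩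
    · rintro ⟨u, hu, ⟨j, hj⟩, rfl⟩
      exact isInjectiveLattice_gradLattice_of_row hv hj
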